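/- A minimax integer program (MIP) has variables $W\in\mathbb R$ and $x_{i,j}$ ($i\in[n]$, $j\in[\ell_i]$, all $\ell_i\ge 1$), $N=\sum_i \ell_i$ in number (not counting $W$), and a matrix $A\in[0,1]^{m\times N}$ with $m\ge 1$; it asks to minimize $W$ subject to $\sum_{j}x_{i,j}=1$ for all $i$, $(Ax)_r\le W$ for all $r\in[m]$, and $x_{i,j}\in\{0,1\}$ for all $i,j$. Its LP relaxation replaces the last condition by $x_{i,j}\in[0,1]$. Let $t$ be the maximum over $i\in[n]$ of the number of rows of $A$ that have a nonzero coefficient at some variable $x_{i,j}$, $j\in[\ell_i]$ (and $t=0$ if $n=0$). For $\mu>0$ and $0<p<1$ put $G(\mu,\delta)=\bigl(e^{\delta}/(1+\delta)^{1+\delta}\bigr)^{\mu}$ and let $H(\mu,p)$ be the least $\delta>0$ such that $\lceil\mu\delta\rceil\,G(\mu,\delta)\le p$ (such a least $\delta$ exists). **Theorem 4.2.** Every such MIP has an optimal basic solution of its LP relaxation, i.e. an optimal solution that is a vertex (extreme point) of the set of feasible points $(x,W)$. Let $(x^*,y^*)$ be any optimal basic solution, so that $y^*$ is the optimal value of the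 relaxation. Randomized rounding of $x^*$ chooses, independently for each $i\in[n]$, exactly one index in $[\ell_i]$, the index $j$ being chosen with probability $x^*_{i,j}$, and sets the variable $x_{i,j}$ with the chosen $j$ to $1$ and the other variables $x_{i,\cdot}$ to $0$. With nonzero probability, the result is a feasible solution of the MIP of value at most $$y^*+\bigl\lceil \min\{y^*,m\}\cdot H\bigl(\min\{y^*,m\},\,1/(et)\bigr)\bigr\rceil ,$$ where the product $\min\{y^*,m\}\cdot H(\cdot,\cdot)$ is read as $0$ if $y^*=0$ (which includes the case $t=0$). -/

import Mathlib

open MeasureTheory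

/-- The Chernoff-Hoeffding bound `G(μ, δ) = (e ^ δ / (1 + δ) ^ (1 + δ)) ^ μ`. -/
noncomputable def chernoffG (μ δ : ℝ) : ℝ :=
  (Real.exp δ / (1 + δ) ^ (1 + δ)) ^ μ

/-- The deviations `δ > 0` for which `⌈μ δ⌉ * G(μ, δ) ≤ p`. -/
noncomputable def admissibleDeviations (μ p : ℝ) : Set ℝ :=
  {δ : ℝ | 0 < δ ∧ ((⌈μ * δ⌉ : ℤ) : ℝ) * chernoffG μ δ ≤ p}

/-- `H(μ, p)`: the least `δ > 0` with `⌈μ δ⌉ * G(μ, δ) ≤ p`. For `μ > 0` and `0 < p < 1` the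
infimum is attained, see `deviationH_isLeast`; so `H(μ, p)` is itself such a `δ`, and it is a lower
bound for the value at `(μ, p)` of every other function selecting such a `δ`. -/
noncomputable def deviationH (μ p : ℝ) : ℝ :=
  sInf (admissibleDeviations μ p)

theorem chernoffG_eq_exp (μ δ : ℝ) (hδ : 0 ≤ δ) :
    chernoffG μ δ = Real.exp (μ * (δ - (1 + δ) * Real.log (1 + δ))) := by
  have h1 : (0 : ℝ) < 1 + δ := by linarith
  rw [chernoffG, Real.rpow_def_of_pos h1, ← Real.exp_sub, ← Real.exp_mul]
  congr 1
  ring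

theorem deviationH_isLeast (μ p : ℝ) (hμ : 0 < μ) (hp0 : 0 < p) (hp1 : p < 1) :
    IsLeast (admissibleDeviations μ p) (deviationH μ p) := by
  have hbdd : BddBelow (admissibleDeviations μ p) := ⟨0, fun δ hδ => hδ.1.le⟩
  have hne : (admissibleDeviations μ p).Nonempty := by
    have hlog : Real.log p < 0 := Real.log_neg hp0 hp1
    have hq : 0 < -Real.log p / μ := div_pos (by linarith) hμ
    have he : 0 < Real.exp 3 := Real.exp_pos 3
    set δ : ℝ := Real.exp 3 + -Real.log p / μ with hδ
    have hδ0 : 0 < δ := by linarith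
    refine ⟨δ, hδ0, ?_⟩
    rw [chernoffG_eq_exp μ δ hδ0.le]
    have hceil : ((⌈μ * δ⌉ : ℤ) : ℝ) ≤ Real.exp (μ * δ) := by
      have h1 := (Int.ceil_lt_add_one (μ * δ)).le
      have h2 := Real.add_one_le_exp (μ * δ)
      linarith
    have hl : 3 ≤ Real.log (1 + δ) := by
      rw [Real.le_log_iff_exp_le (by linarith)]
      linarith
    have hmain : μ * δ + μ * (δ - (1 + δ) * Real.log (1 + δ)) ≤ Real.log p := by
      have h3 : (1 + δ) * 3 ≤ (1 + δ) * Real.log (1 + δ) :=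
        mul_le_mul_of_nonneg_left hl (by linarith)
      have h4 : μ * (δ + (δ - (1 + δ) * Real.log (1 + δ))) ≤ μ * (-(-Real.log p / μ)) :=
        mul_le_mul_of_nonneg_left (by linarith) hμ.le
      have h5 : μ * (-(-Real.log p / μ)) = Real.log p := by
        field_simp
      linarith
    calc ((⌈μ * δ⌉ : ℤ) : ℝ) * Real.exp (μ * (δ - (1 + δ) * Real.log (1 + δ)))
        ≤ Real.exp (μ * δ) * Real.exp (μ * (δ - (1 + δ) * Real.log (1 + δ))) :=
          mul_le_mul_of_nonneg_right hceil (Real.exp_pos _).le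
      _ = Real.exp (μ * δ + μ * (δ - (1 + δ) * Real.log (1 + δ))) := (Real.exp_add _ _).symm
      _ ≤ Real.exp (Real.log p) := Real.exp_le_exp.mpr hmain
      _ = p := Real.exp_log hp0
  refine ⟨?_, fun δ hδ => csInf_le hbdd hδ⟩
  set s : ℝ := deviationH μ p with hs
  set c : ℝ := max 1 ((⌈μ * s⌉ : ℤ) : ℝ) with hc
  let K : Set ℝ :=
    {δ : ℝ | 0 ≤ δ ∧ c * Real.exp (μ * (δ - (1 + δ) * Real.log (1 + δ))) ≤ p}
  have hcont : Continuous fun δ : ℝ => (1 + δ) * Real.log (1 + δ) :=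
    Real.continuous_mul_log.comp (continuous_const.add continuous_id)
  have hK : IsClosed K := by
    refine (isClosed_le continuous_const continuous_id).inter
      (isClosed_le (f := fun δ : ℝ => c * Real.exp (μ * (δ - (1 + δ) * Real.log (1 + δ))))
        ?_ continuous_const)
    exact continuous_const.mul
      (Real.continuous_exp.comp (continuous_const.mul (continuous_id.sub hcont)))
  have hsub : admissibleDeviations μ p ⊆ K := by
    rintro δ ⟨h0, h1⟩
    refine ⟨h0.le, ?_⟩
    rw [chernoffG_eq_exp μ δ h0.le] at h1
    refine le_trans (mul_le_mul_of_nonneg_right (max_le ?_ ?_) (Real.exp_pos _).le) h1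
    · have h2 : 0 < ⌈μ * δ⌉ := Int.ceil_pos.mpr (mul_pos hμ h0)
      exact_mod_cast h2
    · have h2 : s ≤ δ := csInf_le hbdd ⟨h0, by rwa [chernoffG_eq_exp μ δ h0.le]⟩
      exact_mod_cast Int.ceil_mono (mul_le_mul_of_nonneg_left h2 hμ.le)
  obtain ⟨h0, h1⟩ : s ∈ K := closure_minimal hsub hK (csInf_mem_closure hne hbdd)
  have hpos : 0 < s := by
    rcases h0.lt_or_eq with h | h
    · exact h
    · exfalso
      rw [← h] at h1
      have h2 : (1 : ℝ) ≤ c := le_max_left _ _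
      simp at h1
      linarith
  refine ⟨hpos, ?_⟩
  rw [chernoffG_eq_exp μ s h0]
  exact le_trans (mul_le_mul_of_nonneg_right (le_max_right _ _) (Real.exp_pos _).le) h1

/-- A minimax integer program: variables `W` and `x_{i,j}` for `i ∈ [n]`, `j ∈ [ℓ_i]`, and a matrix
`A` with `m` rows, one column for every pair `(i, j)`, and entries in `[0, 1]`. -/
structure MinimaxIP where
  n : ℕ
  m : ℕ
  ℓ : Fin n → ℕ
  A : Matrix (Fin m) ((i : Fin n) × Fin (ℓ i)) ℝ
  A_mem : ∀ r c, A r c ∈ Set.Icc (0 : ℝ) 1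

namespace MinimaxIP

/-- The index set of the variables `x_{i,j}`; it has `N = ∑ i, ℓ_i` elements. -/
abbrev Col (P : MinimaxIP) : Type := (i : Fin P.n) × Fin (P.ℓ i)

/-- `(x, W)` is a feasible solution of the integer program, of objective value `W`. -/
structure IsFeasible (P : MinimaxIP) (x : P.Col → ℝ) (W : ℝ) : Prop where
  sum_eq_one : ∀ i, ∑ j, x ⟨i, j⟩ = 1
  row_le : ∀ r, (P.A.mulVec x) r ≤ W
  integral : ∀ c, x c = 0 ∨ x c = 1

/-- The feasible region of the linear programming relaxation: integrality is relaxed to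
`0 ≤ x_{i,j} ≤ 1`. -/
def lpFeasible (P : MinimaxIP) : Set ((P.Col → ℝ) × ℝ) :=
  {q | (∀ i, ∑ j, q.1 ⟨i, j⟩ = 1) ∧ (∀ r, (P.A.mulVec q.1) r ≤ q.2) ∧
    ∀ c, 0 ≤ q.1 c ∧ q.1 c ≤ 1}

/-- `(x, y)` is an optimal basic feasible solution of the linear programming relaxation: it is a
vertex (extreme point) of the feasible region, and no feasible point has a smaller objective value.
In particular `y` is the optimal value `y*` of the relaxation. -/
structure IsOptimalBasic (P : MinimaxIP) (x : P.Col → ℝ) (y : ℝ) : Prop where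
  basic : (x, y) ∈ Set.extremePoints ℝ P.lpFeasible
  optimal : ∀ q ∈ P.lpFeasible, y ≤ q.2

/-- `t`: the maximum over the groups `i` of the number of rows of `A` that have a nonzero
coefficient at some variable `x_{i,j}` of group `i`. -/
noncomputable def t (P : MinimaxIP) : ℕ :=
  Finset.univ.sup fun i : Fin P.n => Set.ncard {r : Fin P.m | ∃ j, P.A r ⟨i, j⟩ ≠ 0}

/-- An outcome of the rounding: for every group `i` the index `j` of the variable rounded to `1`. -/
abbrev Outcome (P : MinimaxIP) : Type := (i : Fin P.n) → Fin (P.ℓ i)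

/-- The law of randomized rounding of `x`: independently for every group `i`, the index `j` is
chosen with probability `x_{i,j}`. -/
noncomputable def roundingLaw (P : MinimaxIP) (x : P.Col → ℝ) : Measure P.Outcome :=
  Measure.pi fun i => ∑ j, ENNReal.ofReal (x ⟨i, j⟩) • Measure.dirac j

/-- The rounded vector: in every group `i` the chosen variable is `1` and the others are `0`. -/
def rounded (P : MinimaxIP) (J : P.Outcome) : P.Col → ℝ :=
  fun c => if J c.1 = c.2 then 1 else 0

/-- The law of the rounding of a point of the relaxation is a probability measure. -/
theorem isProbabilityMeasure_roundingLaw (P : MinimaxIP) (x : P.Col → ℝ) (W : ℝ)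
    (h : (x, W) ∈ P.lpFeasible) : IsProbabilityMeasure (P.roundingLaw x) := by
  have : ∀ i, IsProbabilityMeasure
      (∑ j, ENNReal.ofReal (x ⟨i, j⟩) • Measure.dirac j : Measure (Fin (P.ℓ i))) := by
    intro i
    constructor
    simp only [Measure.coe_finsetSum, Finset.sum_apply, Measure.smul_apply, smul_eq_mul,
      measure_univ, mul_one]
    rw [← ENNReal.ofReal_sum_of_nonneg fun j _ => (h.2.2 ⟨i, j⟩).1, h.1 i, ENNReal.ofReal_one]
  unfold roundingLaw
  infer_instance

end MinimaxIP

/-! Let y > 0, μ = min {y, m}, δ = H(μ, 1/(et)) and k = ⌈μδ⌉. At a vertex at most m groups are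
fractional (`card_fractional_le`) and the others are rounded deterministically, so the fractional
groups contribute to each row an expected amount ν ≤ μ. Call a row bad if it exceeds y + k. Then its
fractional entries sum to at least ν + k, so their elementary symmetric sum e_k satisfies k! e_k ≥
(ν+1)⋯(ν+k) (`prod_le_factorial_mul_esymmSum`). Hence the bad event is dominated by a sum, over
k-sets T of fractional groups, of multiples of the product of the chosen entries in T. The
expectation of that sum is at most ∏ ν/(ν+j) ≤ G(μ, δ) ≤ 1/(ekt).

A row may share groups with arbitrarily many other rows, so the bad events themselves have no
bounded dependency degree. Each summand, however, sees only k groups, which meet at most kt rows.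
The extended local lemma (`exists_avoiding_of_local`) asks only for this locality of the summands,
and 1/(ekt) meets its threshold for d = kt - 1. -/

/-! ### Analytic estimates: the Chernoff bound and the local lemma weight. -/

/-- Tangent line bound for `s ↦ μ * (s - (1 + s) * log (1 + s))`. -/
theorem chernoff_exponent_tangent_le {μ s s' : ℝ} (hμ : 0 < μ) (hs' : 0 ≤ s') (hs : 0 ≤ s) :
    μ * (s - (1 + s) * Real.log (1 + s)) + μ * (s - s') * Real.log (1 + s) ≥
      μ * (s' - (1 + s') * Real.log (1 + s')) := by
  have h1 : 0 < 1 + s := by linarith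
  have h2 : 0 < 1 + s' := by linarith
  have h := Real.log_le_sub_one_of_pos (div_pos h1 h2)
  rw [Real.log_div h1.ne' h2.ne'] at h
  have h3 := mul_le_mul_of_nonneg_left h h2.le
  have h4 : (1 + s') * ((1 + s) / (1 + s') - 1) = s - s' := by field_simp; ring
  rw [h4] at h3
  nlinarith [mul_le_mul_of_nonneg_left h3 hμ.le]

/-- The Chernoff bound `G(μ, δ)` dominates the bound given by symmetric functions. -/
theorem prod_div_le_chernoffG {μ δ : ℝ} (hμ : 0 < μ) (hδ : 0 ≤ δ) {k : ℕ} (hk : μ * δ ≤ k) :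
    ∏ j ∈ Finset.range k, μ / (μ + (j + 1)) ≤ chernoffG μ δ := by
  have key : ∀ k : ℕ, ∏ j ∈ Finset.range k, μ / (μ + (j + 1)) ≤
      Real.exp (μ * ((k : ℝ) / μ - (1 + k / μ) * Real.log (1 + k / μ))) := by
    intro k
    induction k with
    | zero => simp
    | succ k ih =>
      rw [Finset.prod_range_succ]
      have hpos : (0 : ℝ) < 1 + (k + 1) / μ := by positivity
      have h1 : μ / (μ + (k + 1)) = Real.exp (-Real.log (1 + (k + 1) / μ)) := by
        rw [Real.exp_neg, Real.exp_log hpos]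
        field_simp
      rw [h1]
      refine (mul_le_mul_of_nonneg_right ih (Real.exp_pos _).le).trans ?_
      rw [← Real.exp_add, Real.exp_le_exp]
      -- The exponent is concave with slope `-μ * log (1 + s)`, so over the step from `k / μ` to `(k
      -- + 1) / μ` it falls by at most minus the logarithm of the new factor.
      have h2 := chernoff_exponent_tangent_le (μ := μ) (s := (k + 1) / μ) (s' := k / μ) hμ
        (by positivity) (by positivity)
      have h3 : μ * (((k : ℝ) + 1) / μ - k / μ) = 1 := by field_simp; ring
      rw [h3] at h2
      push_cast
      linarith
  rw [chernoffG_eq_exp μ δ hδ]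
  refine (key k).trans (Real.exp_le_exp.mpr ?_)
  have hδk : δ ≤ k / μ := by rw [le_div_iff₀ hμ]; linarith
  have h := chernoff_exponent_tangent_le (s := δ) (s' := k / μ) hμ (by positivity) hδ
  have hlog : 0 ≤ Real.log (1 + δ) := Real.log_nonneg (by linarith)
  have : μ * (δ - k / μ) * Real.log (1 + δ) ≤ 0 :=
    mul_nonpos_of_nonpos_of_nonneg (mul_nonpos_of_nonneg_of_nonpos hμ.le (by linarith)) hlog
  linarith

/-- The maximizer of β(1-β)^d is β = 1/(d+1), and (1+1/d)^d ≤ e. For d = 0 it would be β = 1, which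
is excluded; β = 1/e suffices there. -/
theorem exists_inv_exp_mul_le_weight (d : ℕ) :
    ∃ β : ℝ, 0 ≤ β ∧ β < 1 ∧ 1 / (Real.exp 1 * (d + 1)) ≤ β * (1 - β) ^ d := by
  rcases Nat.eq_zero_or_pos d with rfl | hd
  · refine ⟨1 / Real.exp 1, by positivity, ?_, by simp⟩
    rw [div_lt_one (Real.exp_pos 1)]
    exact Real.one_lt_exp_iff.mpr one_pos
  · have hd' : (0 : ℝ) < d := by exact_mod_cast hd
    refine ⟨1 / (d + 1), by positivity, ?_, ?_⟩
    · rw [div_lt_one (by positivity)]; linarith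
    · have h1 : (1 - 1 / ((d : ℝ) + 1)) ^ d = ((1 / (d : ℝ) + 1) ^ d)⁻¹ := by
        rw [← inv_pow]; congr 1; field_simp; ring
      have h2 : (1 / (d : ℝ) + 1) ^ d ≤ Real.exp 1 := by
        calc (1 / (d : ℝ) + 1) ^ d ≤ Real.exp (1 / d) ^ d :=
              pow_le_pow_left₀ (by positivity) (Real.add_one_le_exp _) d
          _ = Real.exp 1 := by rw [← Real.exp_nat_mul]; congr 1; field_simp
      rw [h1, one_div_mul_eq_div, one_div, mul_inv, div_eq_mul_inv]
      gcongr

/-! ### Inequalities for elementary symmetric sums. -/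

section SymmetricSums

variable {ι : Type*}

/-- The elementary symmetric sum of degree `k` of the numbers `a i`, `i ∈ F`. -/
noncomputable def esymmSum (a : ι → ℝ) (F : Finset ι) (k : ℕ) : ℝ :=
  ∑ T ∈ F.powersetCard k, ∏ i ∈ T, a i

theorem esymmSum_zero (a : ι → ℝ) (F : Finset ι) : esymmSum a F 0 = 1 := by
  simp [esymmSum]

theorem esymmSum_empty_succ (a : ι → ℝ) (k : ℕ) : esymmSum a ∅ (k + 1) = 0 := by
  rw [esymmSum, Finset.powersetCard_eq_empty.mpr (by simp), Finset.sum_empty]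

theorem esymmSum_nonneg {a : ι → ℝ} {F : Finset ι} (ha : ∀ i ∈ F, 0 ≤ a i) (k : ℕ) :
    0 ≤ esymmSum a F k :=
  Finset.sum_nonneg fun _ hT =>
    Finset.prod_nonneg fun i hi => ha i ((Finset.mem_powersetCard.mp hT).1 hi)

variable [DecidableEq ι]

theorem esymmSum_insert (a : ι → ℝ) {F : Finset ι} {i : ι} (hi : i ∉ F) (k : ℕ) :
    esymmSum a (insert i F) (k + 1) = esymmSum a F (k + 1) + a i * esymmSum a F k := by
  unfold esymmSum
  rw [Finset.powersetCard_succ_insert hi, Finset.sum_union, Finset.sum_image, Finset.mul_sum]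
  · congr 1
    refine Finset.sum_congr rfl fun T hT => ?_
    exact Finset.prod_insert fun h => hi ((Finset.mem_powersetCard.mp hT).1 h)
  · intro S hS T hT h
    have hS' : i ∉ S := fun h => hi ((Finset.mem_powersetCard.mp hS).1 h)
    have hT' : i ∉ T := fun h => hi ((Finset.mem_powersetCard.mp hT).1 h)
    rw [← Finset.erase_insert hS', ← Finset.erase_insert hT', h]
  · rw [Finset.disjoint_left]
    intro T hT hT'
    obtain ⟨S, -, rfl⟩ := Finset.mem_image.mp hT'
    exact hi ((Finset.mem_powersetCard.mp hT).1 (Finset.mem_insert_self i S))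

/-- Expanding e_k · e_1 yields every (k+1)-subset k+1 times, plus nonnegative terms with a repeated
factor. -/
theorem esymmSum_succ_le {a : ι → ℝ} {F : Finset ι} (ha : ∀ i ∈ F, 0 ≤ a i) (k : ℕ) :
    (k + 1) * esymmSum a F (k + 1) ≤ esymmSum a F k * ∑ i ∈ F, a i := by
  induction F using Finset.induction_on generalizing k with
  | empty => simp [esymmSum_empty_succ]
  | insert i F hi ih =>
    have hF : ∀ j ∈ F, 0 ≤ a j := fun j hj => ha j (Finset.mem_insert_of_mem hj)
    have hai := ha i (Finset.mem_insert_self i F)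
    rw [esymmSum_insert a hi, Finset.sum_insert hi]
    have h0 := ih hF k
    cases k with
    | zero => simp only [esymmSum_zero] at *; push_cast at *; linarith
    | succ k =>
      rw [esymmSum_insert a hi]
      have h1 := mul_le_mul_of_nonneg_left (ih hF k) hai
      have h2 : 0 ≤ a i * esymmSum a F k * a i :=
        mul_nonneg (mul_nonneg hai (esymmSum_nonneg hF k)) hai
      push_cast at *
      nlinarith

/-- In the same expansion the terms with a repeated factor total at most k e_k, because `a i ^ 2 ≤ a
i`. -/
theorem le_esymmSum_succ {a : ι → ℝ} {F : Finset ι} (ha : ∀ i ∈ F, 0 ≤ a i ∧ a i ≤ 1) (k : ℕ) :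
    esymmSum a F k * (∑ i ∈ F, a i - k) ≤ (k + 1) * esymmSum a F (k + 1) := by
  induction F using Finset.induction_on generalizing k with
  | empty => cases k <;> simp [esymmSum_empty_succ]
  | insert i F hi ih =>
    have hF : ∀ j ∈ F, 0 ≤ a j ∧ a j ≤ 1 := fun j hj => ha j (Finset.mem_insert_of_mem hj)
    obtain ⟨hai, hai1⟩ := ha i (Finset.mem_insert_self i F)
    rw [esymmSum_insert a hi, Finset.sum_insert hi]
    have h0 := ih hF k
    cases k with
    | zero => simp only [esymmSum_zero] at *; push_cast at *; linarith
    | succ k =>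
      rw [esymmSum_insert a hi]
      have h1 := mul_le_mul_of_nonneg_left (ih hF k) hai
      have h2 : 0 ≤ a i * esymmSum a F k * (1 - a i) :=
        mul_nonneg (mul_nonneg hai (esymmSum_nonneg (fun j hj => (hF j hj).1) k)) (by linarith)
      push_cast at *
      nlinarith

theorem factorial_mul_esymmSum_le_pow {a : ι → ℝ} {F : Finset ι} (ha : ∀ i ∈ F, 0 ≤ a i) (k : ℕ) :
    k.factorial * esymmSum a F k ≤ (∑ i ∈ F, a i) ^ k := by
  induction k with
  | zero => simp [esymmSum_zero]
  | succ k ih =>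
    have h := mul_le_mul_of_nonneg_left (esymmSum_succ_le ha k) (k.factorial.cast_nonneg (α := ℝ))
    have h' := mul_le_mul_of_nonneg_right ih (Finset.sum_nonneg ha)
    rw [Nat.factorial_succ, pow_succ]
    push_cast
    nlinarith

/-- If numbers in `[0, 1]` have a sum of at least `ν + k`, then `k!` times their elementary
symmetric sum of degree `k` is at least `(ν + 1) ⋯ (ν + k)`. -/
theorem prod_le_factorial_mul_esymmSum {a : ι → ℝ} {F : Finset ι}
    (ha : ∀ i ∈ F, 0 ≤ a i ∧ a i ≤ 1) {ν : ℝ} (hν : 0 ≤ ν) (k : ℕ)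
    (h : ν + k ≤ ∑ i ∈ F, a i) :
    ∏ j ∈ Finset.range k, (ν + (j + 1)) ≤ k.factorial * esymmSum a F k := by
  induction k generalizing ν with
  | zero => simp [esymmSum_zero]
  | succ k ih =>
    push_cast at h
    -- Shifting ν by one gives the factors ν+2, …, ν+k+1; the remaining factor ν+1 comes from `∑ a -
    -- k ≥ ν + 1`.
    have h1 := ih (ν := ν + 1) (by linarith) (by linarith)
    have h2 := mul_le_mul_of_nonneg_left (le_esymmSum_succ ha k) (k.factorial.cast_nonneg (α := ℝ))
    have h3 : 0 ≤ k.factorial * esymmSum a F k :=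
      mul_nonneg (Nat.cast_nonneg _) (esymmSum_nonneg (fun i hi => (ha i hi).1) k)
    rw [Finset.prod_range_succ', Nat.factorial_succ]
    have h4 : ∏ j ∈ Finset.range k, (ν + (((j + 1 : ℕ) : ℝ) + 1)) =
        ∏ j ∈ Finset.range k, (ν + 1 + ((j : ℝ) + 1)) :=
      Finset.prod_congr rfl fun j _ => by push_cast; ring
    rw [h4]
    have h5 := mul_le_mul_of_nonneg_right h1 (show 0 ≤ ν + 1 by linarith)
    have h6 := mul_le_mul_of_nonneg_left (show ν + 1 ≤ ∑ i ∈ F, a i - k by linarith) h3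
    push_cast
    simp only [zero_add]
    nlinarith

end SymmetricSums

/-! ### The extended local lemma. -/

section LocalLemma

variable {Ω ι κ : Type*} [Fintype Ω]

open Classical in
/-- The weight of the outcomes at which none of the events `B i`, `i ∈ I`, occurs, each counted
with the factor `f`. -/
noncomputable def avoidSum (w : Ω → ℝ) (B : ι → Set Ω) (f : Ω → ℝ) (I : Finset ι) : ℝ :=
  ∑ ω, w ω * (f ω * if ∀ i ∈ I, ω ∉ B i then 1 else 0)

/-- The comparison of `f` and `g` is needed only on the support of `w`: in the application the
domination relies on the non-fractional groups taking their forced values. -/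
theorem avoidSum_mono {w f g : Ω → ℝ} {B : ι → Set Ω} {I I' : Finset ι} (hw : ∀ ω, 0 ≤ w ω)
    (hf : ∀ ω, 0 ≤ f ω) (hfg : ∀ ω, w ω ≠ 0 → f ω ≤ g ω) (hI : I' ⊆ I) :
    avoidSum w B f I ≤ avoidSum w B g I' := by
  refine Finset.sum_le_sum fun ω _ => ?_
  by_cases h0 : w ω = 0
  · simp [h0]
  refine mul_le_mul_of_nonneg_left ?_ (hw ω)
  have hg : 0 ≤ g ω := (hf ω).trans (hfg ω h0)
  split_ifs with h1 h2 h2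
  · simpa using hfg ω h0
  · exact absurd (fun i hi => h1 i (hI hi)) h2
  · simpa using hg
  · simp

variable [DecidableEq ι]

theorem avoidSum_insert (w : Ω → ℝ) (B : ι → Set Ω) (I : Finset ι) (i : ι) :
    avoidSum w B 1 (insert i I) =
      avoidSum w B 1 I - avoidSum w B ((B i).indicator 1) I := by
  unfold avoidSum
  rw [← Finset.sum_sub_distrib]
  refine Finset.sum_congr rfl fun ω _ => ?_
  have hiff : (∀ a ∈ insert i I, ω ∉ B a) ↔ ω ∉ B i ∧ ∀ a ∈ I, ω ∉ B a :=
    by simp [or_imp, forall_and]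
  by_cases h : ω ∈ B i <;> by_cases h' : ∀ a ∈ I, ω ∉ B a
  · rw [if_neg (by tauto), if_pos h']; simp [h]
  · rw [if_neg (by tauto), if_neg h']; simp
  · rw [if_pos (by tauto), if_pos h']; simp [h]
  · rw [if_neg (by tauto), if_neg h']; simp

/-- The extended Lovász local lemma for a finite weighted space: the probability of each event
is bounded by the expectation of a sum of nonnegative functions, each of which is independent
of all but `d` of the other events. -/
theorem exists_avoiding_of_local (w : Ω → ℝ) (hw : ∀ ω, 0 ≤ w ω) (hw1 : ∑ ω, w ω = 1)
    [Fintype ι] (B : ι → Set Ω) (K : ι → Finset κ) (C : ι → κ → Ω → ℝ) (N : ι → κ → Finset ι)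
    (d : ℕ) (β : ℝ) (hβ0 : 0 ≤ β) (hβ1 : β < 1)
    (hC : ∀ i, ∀ k ∈ K i, ∀ ω, 0 ≤ C i k ω)
    (hcard : ∀ i, ∀ k ∈ K i, ((N i k).erase i).card ≤ d)
    (hind : ∀ i, ∀ k ∈ K i, ∀ I, Disjoint I (N i k) →
      avoidSum w B (C i k) I = (∑ ω, w ω * C i k ω) * avoidSum w B 1 I)
    (hbound : ∀ i ω, w ω ≠ 0 → ω ∈ B i → 1 ≤ ∑ k ∈ K i, C i k ω)
    (hsum : ∀ i, ∑ k ∈ K i, ∑ ω, w ω * C i k ω ≤ β * (1 - β) ^ d) :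
    ∃ ω, 0 < w ω ∧ ∀ i, ω ∉ B i := by
  have hnn : ∀ I, 0 ≤ avoidSum w B 1 I := fun I =>
    Finset.sum_nonneg fun ω _ => mul_nonneg (hw ω) (by split_ifs <;> simp)
  -- Division-free form of P(B i | no event of I occurs) ≤ β, by strong induction on the size of I.
  have key : ∀ n : ℕ, ∀ I : Finset ι, I.card = n → ∀ i ∉ I,
      avoidSum w B ((B i).indicator 1) I ≤ β * avoidSum w B 1 I := by
    intro n
    induction n using Nat.strong_induction_on with
    | _ n ih =>
    intro I hI i hi
    -- Each further event to be avoided keeps at least a fraction 1-β of the weight, by the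
    -- induction hypothesis for sets smaller than I.
    have chain : ∀ S R : Finset ι, Disjoint S R → S ∪ R ⊆ I →
        (1 - β) ^ S.card * avoidSum w B 1 R ≤ avoidSum w B 1 (S ∪ R) := by
      intro S
      induction S using Finset.induction_on with
      | empty => intro R _ _; simp
      | insert a S ha ihS =>
        intro R hSR hsub
        rw [Finset.insert_union] at *
        have haR : a ∉ R := Finset.disjoint_left.mp hSR (Finset.mem_insert_self a S)
        have haSR : a ∉ S ∪ R := by simp [ha, haR]
        have h1 := ihS R (Finset.disjoint_of_subset_left (Finset.subset_insert a S) hSR)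
          ((Finset.subset_insert a _).trans hsub)
        have hlt : (S ∪ R).card < n := by
          rw [← hI]
          exact Finset.card_lt_card ((Finset.ssubset_insert haSR).trans_subset hsub)
        have h2 := ih _ hlt (S ∪ R) rfl a haSR
        rw [avoidSum_insert, Finset.card_insert_of_notMem ha, pow_succ]
        have h3 := mul_le_mul_of_nonneg_left h1 (show 0 ≤ 1 - β by linarith)
        nlinarith
    have hterm : ∀ k ∈ K i, avoidSum w B (C i k) I * (1 - β) ^ d ≤
        (∑ ω, w ω * C i k ω) * avoidSum w B 1 I := by
      intro k hk
      -- Forgetting the events in `N i k` makes `C i k` independent of the rest; restoring them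
      -- costs at most a factor (1-β)^d. Since `i ∉ I`, the event `i` itself is not among them.
      have h1 : avoidSum w B (C i k) I ≤ avoidSum w B (C i k) (I \ N i k) :=
        avoidSum_mono hw (hC i k hk) (fun _ _ => le_rfl) Finset.sdiff_subset
      rw [hind i k hk _ Finset.sdiff_disjoint] at h1
      have h2 := chain (I ∩ N i k) (I \ N i k)
        (Finset.disjoint_sdiff_inter I (N i k)).symm
        (by rw [Finset.union_comm, Finset.sdiff_union_inter])
      rw [Finset.union_comm, Finset.sdiff_union_inter] at h2
      have hle : (I ∩ N i k).card ≤ d := by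
        refine (Finset.card_le_card fun a ha => ?_).trans (hcard i k hk)
        rw [Finset.mem_inter] at ha
        exact Finset.mem_erase.mpr ⟨fun h => hi (h ▸ ha.1), ha.2⟩
      have h3 : (1 - β) ^ d ≤ (1 - β) ^ (I ∩ N i k).card :=
        pow_le_pow_of_le_one (by linarith) (by linarith) hle
      have hE : 0 ≤ ∑ ω, w ω * C i k ω :=
        Finset.sum_nonneg fun ω _ => mul_nonneg (hw ω) (hC i k hk ω)
      have hp : 0 ≤ (1 - β) ^ d := pow_nonneg (by linarith) d
      calc avoidSum w B (C i k) I * (1 - β) ^ d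
          ≤ (∑ ω, w ω * C i k ω) * avoidSum w B 1 (I \ N i k) * (1 - β) ^ d :=
            mul_le_mul_of_nonneg_right h1 hp
        _ = (∑ ω, w ω * C i k ω) * ((1 - β) ^ d * avoidSum w B 1 (I \ N i k)) := by ring
        _ ≤ (∑ ω, w ω * C i k ω) * avoidSum w B 1 I :=
            mul_le_mul_of_nonneg_left
              ((mul_le_mul_of_nonneg_right h3 (hnn _)).trans h2) hE
    have htot : avoidSum w B ((B i).indicator 1) I ≤ ∑ k ∈ K i, avoidSum w B (C i k) I := by
      have h1 : avoidSum w B ((B i).indicator 1) I ≤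
          avoidSum w B (fun ω => ∑ k ∈ K i, C i k ω) I := by
        refine avoidSum_mono hw (fun ω => Set.indicator_nonneg (fun _ _ => zero_le_one) ω)
          (fun ω h0 => ?_) le_rfl
        by_cases h : ω ∈ B i
        · simpa [h] using hbound i ω h0 h
        · simpa [h] using Finset.sum_nonneg fun k hk => hC i k hk ω
      refine h1.trans_eq ?_
      unfold avoidSum
      rw [Finset.sum_comm]
      refine Finset.sum_congr rfl fun ω _ => ?_
      rw [Finset.sum_mul, Finset.mul_sum]
    have hp : 0 < (1 - β) ^ d := pow_pos (by linarith) d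
    refine le_of_mul_le_mul_right ?_ hp
    calc avoidSum w B ((B i).indicator 1) I * (1 - β) ^ d
        ≤ (∑ k ∈ K i, avoidSum w B (C i k) I) * (1 - β) ^ d :=
          mul_le_mul_of_nonneg_right htot hp.le
      _ ≤ ∑ k ∈ K i, (∑ ω, w ω * C i k ω) * avoidSum w B 1 I := by
          rw [Finset.sum_mul]; exact Finset.sum_le_sum hterm
      _ ≤ β * (1 - β) ^ d * avoidSum w B 1 I := by
          rw [← Finset.sum_mul]; exact mul_le_mul_of_nonneg_right (hsum i) (hnn I)
      _ = β * avoidSum w B 1 I * (1 - β) ^ d := by ring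
  have hpos : ∀ I : Finset ι, 0 < avoidSum w B 1 I := by
    intro I
    induction I using Finset.induction_on with
    | empty => simp [avoidSum, hw1]
    | insert a I ha ih =>
      rw [avoidSum_insert]
      have := key _ I rfl a ha
      nlinarith
  by_contra hcon
  push Not at hcon
  refine (hpos Finset.univ).ne' (Finset.sum_eq_zero fun ω _ => ?_)
  rcases (hw ω).eq_or_lt with h | h
  · simp [← h]
  · obtain ⟨i, hi⟩ := hcon ω h
    rw [if_neg fun h' => h' i (Finset.mem_univ i) hi]
    simp

end LocalLemma

/-! ### Independent choices on a finite product. -/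

section ProductWeight

variable {ι : Type*} [Fintype ι] {α : ι → Type*}

/-- The weight of an outcome under independent choices with the weights `p i`. -/
def prodWeight (p : ∀ i, α i → ℝ) (J : ∀ i, α i) : ℝ := ∏ i, p i (J i)

variable [DecidableEq ι] [∀ i, Fintype (α i)]

theorem sum_prodWeight {p : ∀ i, α i → ℝ} (hp : ∀ i, ∑ j, p i j = 1) :
    ∑ J, prodWeight p J = 1 := by
  simp [prodWeight, ← Fintype.prod_sum, hp]

theorem sum_prodWeight_mul_prod {p : ∀ i, α i → ℝ} (hp : ∀ i, ∑ j, p i j = 1)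
    (f : ∀ i, α i → ℝ) (T : Finset ι) :
    ∑ J, prodWeight p J * ∏ i ∈ T, f i (J i) = ∏ i ∈ T, ∑ j, p i j * f i j := by
  have h1 : ∀ J : ∀ i, α i, prodWeight p J * ∏ i ∈ T, f i (J i) =
      ∏ i, p i (J i) * (if i ∈ T then f i (J i) else 1) := fun J => by
    rw [Finset.prod_mul_distrib, Fintype.prod_ite_mem, prodWeight]
  simp_rw [h1]
  rw [← Fintype.prod_sum fun i j => p i j * (if i ∈ T then f i j else 1),
    ← Fintype.prod_ite_mem T]
  refine Finset.prod_congr rfl fun i _ => ?_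
  split_ifs
  · rfl
  · simpa using hp i

/-- Functions of disjoint sets of independent choices are uncorrelated. -/
theorem sum_prodWeight_mul_mul {p : ∀ i, α i → ℝ} (hp : ∀ i, ∑ j, p i j = 1) (T : Finset ι)
    {f g : (∀ i, α i) → ℝ} (hf : DependsOn f (T : Set ι)) (hg : DependsOn g (T : Set ι)ᶜ) :
    ∑ J, prodWeight p J * (f J * g J) =
      (∑ J, prodWeight p J * f J) * ∑ J, prodWeight p J * g J := by
  -- Two independent copies exchange their coordinates outside T. This preserves the joint weight,
  -- and afterwards `f` reads the first copy while `g` reads the second.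
  let σ : (∀ i, α i) × (∀ i, α i) → (∀ i, α i) × (∀ i, α i) :=
    fun q => (T.piecewise q.1 q.2, T.piecewise q.2 q.1)
  have hσ : Function.Involutive σ := by
    rintro ⟨J, J'⟩
    ext i <;> by_cases h : i ∈ T <;> simp [σ, h]
  have hw : ∀ q : (∀ i, α i) × (∀ i, α i),
      prodWeight p (σ q).1 * prodWeight p (σ q).2 = prodWeight p q.1 * prodWeight p q.2 := by
    rintro ⟨J, J'⟩
    simp only [prodWeight, ← Finset.prod_mul_distrib, σ]
    refine Finset.prod_congr rfl fun i _ => ?_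
    by_cases h : i ∈ T <;> simp [h, mul_comm]
  have hfg : ∀ q : (∀ i, α i) × (∀ i, α i), f (σ q).1 * g (σ q).1 = f q.1 * g q.2 := by
    rintro ⟨J, J'⟩
    congr 1
    · exact hf fun i hi => by simp [σ, Finset.mem_coe.mp hi]
    · exact hg fun i hi => by simp [σ, show i ∉ T from hi]
  calc ∑ J, prodWeight p J * (f J * g J)
      = ∑ q : (∀ i, α i) × (∀ i, α i),
          prodWeight p q.1 * prodWeight p q.2 * (f q.1 * g q.1) := by
        rw [Fintype.sum_prod_type]
        refine Finset.sum_congr rfl fun J _ => ?_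
        simp only [mul_right_comm (prodWeight p J) _ (f J * g J)]
        rw [← Finset.mul_sum, sum_prodWeight hp, mul_one]
    _ = ∑ q : (∀ i, α i) × (∀ i, α i),
          prodWeight p q.1 * prodWeight p q.2 * (f q.1 * g q.2) := by
        rw [← Equiv.sum_comp hσ.toPerm]
        refine Finset.sum_congr rfl fun q _ => ?_
        rw [Function.Involutive.coe_toPerm, hw, hfg]
    _ = (∑ J, prodWeight p J * f J) * ∑ J, prodWeight p J * g J := by
        rw [Fintype.sum_prod_type, Finset.sum_mul_sum]
        refine Finset.sum_congr rfl fun J _ => Finset.sum_congr rfl fun J' _ => ?_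
        ring

end ProductWeight

/-! ### Vertices of the relaxation and the support of the rounding law. -/

namespace MinimaxIP

variable {P : MinimaxIP}

theorem exists_fractional_pair {x : P.Col → ℝ} {y : ℝ} (h : (x, y) ∈ P.lpFeasible) {i : Fin P.n}
    (hi : ∀ j, x ⟨i, j⟩ ≠ 1) :
    ∃ a b, a ≠ b ∧ (0 < x ⟨i, a⟩ ∧ x ⟨i, a⟩ < 1) ∧ (0 < x ⟨i, b⟩ ∧ x ⟨i, b⟩ < 1) := by
  obtain ⟨hs, -, hx⟩ := h
  have hlt : ∀ j, x ⟨i, j⟩ < 1 := fun j => lt_of_le_of_ne (hx _).2 (hi j)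
  have h0 : ∃ a ∈ Finset.univ, x ⟨i, a⟩ ≠ 0 :=
    Finset.exists_ne_zero_of_sum_ne_zero (by rw [hs i]; exact one_ne_zero)
  obtain ⟨a, -, ha⟩ := h0
  have h1 : ∃ b ∈ Finset.univ.erase a, x ⟨i, b⟩ ≠ 0 := by
    refine Finset.exists_ne_zero_of_sum_ne_zero ?_
    have := Finset.add_sum_erase Finset.univ (fun j => x ⟨i, j⟩) (Finset.mem_univ a)
    have h2 := hs i
    have h3 := hlt a
    simp only at *
    intro h4
    linarith
  obtain ⟨b, hb, hb0⟩ := h1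
  exact ⟨a, b, (Finset.ne_of_mem_erase hb).symm,
    ⟨lt_of_le_of_ne (hx _).1 ha.symm, hlt a⟩, ⟨lt_of_le_of_ne (hx _).1 hb0.symm, hlt b⟩⟩

theorem sum_single_col (k : Fin P.n) (a : Fin (P.ℓ k)) (i : Fin P.n) :
    ∑ j, (Pi.single (⟨k, a⟩ : P.Col) (1 : ℝ) : P.Col → ℝ) ⟨i, j⟩ = if i = k then 1 else 0 := by
  split_ifs with h
  · subst h
    rw [Finset.sum_eq_single a]
    · simp
    · intro j _ hj
      exact Pi.single_eq_of_ne (fun h => hj (by simpa using h)) _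
    · simp
  · refine Finset.sum_eq_zero fun j _ => Pi.single_eq_of_ne (fun h' => h ?_) _
    exact congrArg Sigma.fst h'

/-- A vertex of the relaxation has at most as many groups with fractional variables as there are
rows. -/
theorem card_fractional_le {x : P.Col → ℝ} {y : ℝ}
    (h : (x, y) ∈ Set.extremePoints ℝ P.lpFeasible) :
    (Finset.univ.filter fun i : Fin P.n => ∀ j, x ⟨i, j⟩ ≠ 1).card ≤ P.m := by
  rw [mem_extremePoints] at h
  obtain ⟨hf, hext⟩ := h
  by_contra hcard
  let F := {i : Fin P.n // ∀ j, x ⟨i, j⟩ ≠ 1}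
  choose a b hab ha hb using fun i : F => exists_fractional_pair hf i.2
  -- Each direction moves mass between two fractional variables of one group, preserving the group
  -- sum. More than m images in ℝ^m are dependent, so some nonzero combination also preserves all
  -- rows.
  let v : F → P.Col → ℝ := fun i =>
    Pi.single (⟨i, a i⟩ : P.Col) 1 - Pi.single (⟨i, b i⟩ : P.Col) 1
  have hdep : ¬ LinearIndependent ℝ fun i => P.A.mulVec (v i) := by
    intro hli
    have h1 := hli.fintype_card_le_finrank
    rw [Module.finrank_fin_fun, Fintype.card_subtype] at h1
    exact hcard h1
  obtain ⟨g, hg, i₀, hi₀⟩ := Fintype.not_linearIndependent_iff.mp hdep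
  set z : P.Col → ℝ := ∑ i, g i • v i with hz
  have hAz : P.A.mulVec z = 0 := by
    rw [← hg, hz, Matrix.mulVec_sum]
    simp only [Matrix.mulVec_smul]
  have hz_apply : ∀ c, z c = ∑ i, g i * v i c := fun c => by simp [hz]
  have hzsum : ∀ i, ∑ j, z ⟨i, j⟩ = 0 := by
    intro i
    simp only [hz_apply]
    rw [Finset.sum_comm]
    refine Finset.sum_eq_zero fun k _ => ?_
    rw [← Finset.mul_sum]
    simp only [v, Pi.sub_apply]
    rw [Finset.sum_sub_distrib, sum_single_col, sum_single_col, sub_self, mul_zero]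
  have hzfrac : ∀ c, z c ≠ 0 → 0 < x c ∧ x c < 1 := by
    intro c hc
    rw [hz_apply] at hc
    obtain ⟨k, -, hk⟩ := Finset.exists_ne_zero_of_sum_ne_zero hc
    by_cases h1 : c = ⟨k, a k⟩
    · rw [h1]; exact ha k
    by_cases h2 : c = ⟨k, b k⟩
    · rw [h2]; exact hb k
    exact absurd (by simp [v, Pi.single_eq_of_ne h1, Pi.single_eq_of_ne h2]) hk
  have hz0 : z ⟨i₀, a i₀⟩ ≠ 0 := by
    rw [hz_apply, Finset.sum_eq_single i₀]
    · have : (⟨i₀, a i₀⟩ : P.Col) ≠ ⟨i₀, b i₀⟩ := fun h => hab i₀ (by simpa using h)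
      simpa [v, Pi.single_eq_of_ne this] using hi₀
    · intro k _ hk
      have h1 : ∀ e, (⟨i₀, a i₀⟩ : P.Col) ≠ ⟨k, e⟩ := fun e h =>
        hk (Subtype.ext (congrArg Sigma.fst h).symm)
      simp [v, Pi.single_eq_of_ne (h1 _)]
    · simp
  -- As `z` lives on strictly fractional variables, small moves along both `z` and `-z` stay
  -- feasible, and the vertex would be the midpoint of two other feasible points.
  have hε : ∀ᶠ ε : ℝ in nhdsWithin 0 (Set.Ioi 0), ∀ c,
      (0 ≤ x c + ε * z c ∧ x c + ε * z c ≤ 1) ∧ (0 ≤ x c - ε * z c ∧ x c - ε * z c ≤ 1) := by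
    rw [Filter.eventually_all]
    intro c
    by_cases hc : z c = 0
    · have := hf.2.2 c
      simp only [hc, mul_zero, add_zero, sub_zero]
      exact Filter.Eventually.of_forall fun _ => ⟨this, this⟩
    have hmem : Set.Ioo (0 : ℝ) 1 ∈ nhds (x c) := Ioo_mem_nhds (hzfrac c hc).1 (hzfrac c hc).2
    have t1 : Filter.Tendsto (fun ε : ℝ => x c + ε * z c) (nhds 0) (nhds (x c)) := by
      have : Continuous fun ε : ℝ => x c + ε * z c := by fun_prop
      simpa using this.tendsto 0
    have t2 : Filter.Tendsto (fun ε : ℝ => x c - ε * z c) (nhds 0) (nhds (x c)) := by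
      have : Continuous fun ε : ℝ => x c - ε * z c := by fun_prop
      simpa using this.tendsto 0
    filter_upwards [nhdsWithin_le_nhds (t1 hmem), nhdsWithin_le_nhds (t2 hmem)] with ε h1 h2
    exact ⟨⟨h1.1.le, h1.2.le⟩, ⟨h2.1.le, h2.2.le⟩⟩
  obtain ⟨ε, hεb, hε0⟩ := (hε.and self_mem_nhdsWithin).exists
  have hε0 : 0 < ε := hε0
  have hfeas : ∀ s : ℝ, (∀ c, 0 ≤ x c + s * z c ∧ x c + s * z c ≤ 1) →
      (x + s • z, y) ∈ P.lpFeasible := by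
    intro s hs
    refine ⟨fun i => ?_, fun r => ?_, hs⟩
    · simp only [Pi.add_apply, Pi.smul_apply, smul_eq_mul]
      rw [Finset.sum_add_distrib, ← Finset.mul_sum, hzsum, hf.1 i, mul_zero, add_zero]
    · rw [Matrix.mulVec_add, Matrix.mulVec_smul, hAz, smul_zero, add_zero]
      exact hf.2.1 r
  have h1 := hfeas ε fun c => (hεb c).1
  have h2 := hfeas (-ε) fun c => by
    simpa [sub_eq_add_neg] using (hεb c).2
  have h3 := (hext _ h1 _ h2 ⟨1 / 2, 1 / 2, by norm_num, by norm_num, by norm_num, by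
    ext c
    · simp only [Prod.fst_add, Prod.smul_fst, Pi.add_apply, Pi.smul_apply, smul_eq_mul]
      ring
    · simp only [Prod.snd_add, Prod.smul_snd, smul_eq_mul]
      ring⟩).1
  have h4 := congrFun (congrArg Prod.fst h3) ⟨i₀, a i₀⟩
  simp only [Pi.add_apply, Pi.smul_apply, smul_eq_mul, add_eq_left, mul_eq_zero] at h4
  exact h4.elim hε0.ne' hz0

theorem nonneg_of_mem_lpFeasible (hm : 0 < P.m) {q : (P.Col → ℝ) × ℝ} (h : q ∈ P.lpFeasible) :
    0 ≤ q.2 :=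
  (Finset.sum_nonneg fun c _ => mul_nonneg (P.A_mem ⟨0, hm⟩ c).1 (h.2.2 c).1).trans
    (h.2.1 ⟨0, hm⟩)

theorem isClosed_lpFeasible (P : MinimaxIP) : IsClosed P.lpFeasible := by
  simp only [lpFeasible, Set.ofPred_and, Set.ofPred_forall]
  refine IsClosed.inter ?_ (IsClosed.inter ?_ ?_)
  · exact isClosed_iInter fun i => isClosed_eq (by fun_prop) continuous_const
  · refine isClosed_iInter fun r => isClosed_le ?_ continuous_snd
    exact (continuous_apply r).comp (continuous_const.matrix_mulVec continuous_fst)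
  · refine isClosed_iInter fun c => IsClosed.inter ?_ ?_
    · exact isClosed_le continuous_const (by fun_prop)
    · exact isClosed_le (by fun_prop) continuous_const

theorem lpFeasible_nonempty (hℓ : ∀ i, 0 < P.ℓ i) : P.lpFeasible.Nonempty := by
  let x : P.Col → ℝ := fun c => if c.2 = ⟨0, hℓ c.1⟩ then 1 else 0
  obtain ⟨W, hW⟩ := (Set.finite_range (P.A.mulVec x)).bddAbove
  refine ⟨(x, W), fun i => ?_, fun r => hW ⟨r, rfl⟩, fun c => ?_⟩
  · exact Fintype.sum_ite_eq' (⟨0, hℓ i⟩ : Fin (P.ℓ i)) fun _ => (1 : ℝ)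
  · simp only [x]
    split_ifs <;> simp

/-- The region is unbounded in W, but its slices W ≤ B are compact. The slice at the minimum is the
optimal face and has an extreme point. A segment through that point has both endpoints in the face,
as neither lies below the minimum; so the point is extreme in the whole region. -/
theorem exists_isOptimalBasic (hm : 0 < P.m) (hℓ : ∀ i, 0 < P.ℓ i) :
    ∃ (x : P.Col → ℝ) (y : ℝ), P.IsOptimalBasic x y := by
  obtain ⟨q₀, hq₀⟩ := lpFeasible_nonempty hℓ
  have hcompact : ∀ B : ℝ, IsCompact (P.lpFeasible ∩ {q | q.2 ≤ B}) := by
    intro B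
    refine (isCompact_Icc (a := ((0, 0) : (P.Col → ℝ) × ℝ)) (b := (1, B))).of_isClosed_subset
      (P.isClosed_lpFeasible.inter (isClosed_le continuous_snd continuous_const)) ?_
    rintro q ⟨hq, hqB⟩
    exact ⟨⟨fun c => (hq.2.2 c).1, nonneg_of_mem_lpFeasible hm hq⟩, ⟨fun c => (hq.2.2 c).2, hqB⟩⟩
  obtain ⟨q₁, hq₁, hmin⟩ := (hcompact q₀.2).exists_isMinOn ⟨q₀, hq₀, le_refl q₀.2⟩
    continuous_snd.continuousOn
  have hopt : ∀ q ∈ P.lpFeasible, q₁.2 ≤ q.2 := by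
    intro q hq
    by_cases h : q.2 ≤ q₀.2
    · exact hmin ⟨hq, h⟩
    · exact le_trans hq₁.2 (not_le.mp h).le
  obtain ⟨q, hq⟩ := (hcompact q₁.2).extremePoints_nonempty ⟨q₁, hq₁.1, le_refl q₁.2⟩
  have hqF := hq.1
  have hqeq : q.2 = q₁.2 := le_antisymm hqF.2 (hopt q hqF.1)
  refine ⟨q.1, q.2, ?_, fun q' hq' => hqeq ▸ hopt q' hq'⟩
  rw [mem_extremePoints] at hq ⊢
  refine ⟨hqF.1, fun u hu v hv huv => ?_⟩
  obtain ⟨s, t, hs, ht, hst, hc⟩ := id huv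
  have h2 : s * u.2 + t * v.2 = q.2 := congrArg Prod.snd hc
  have hu' := hopt u hu
  have hv' := hopt v hv
  have hsu : u.2 ≤ q₁.2 := by
    have h3 : q₁.2 = s * q₁.2 + t * q₁.2 := by rw [← add_mul, hst, one_mul]
    by_contra hcon
    nlinarith [mul_lt_mul_of_pos_left (not_le.mp hcon) hs, mul_le_mul_of_nonneg_left hv' ht.le]
  have htv : v.2 ≤ q₁.2 := by
    have h3 : q₁.2 = s * q₁.2 + t * q₁.2 := by rw [← add_mul, hst, one_mul]
    by_contra hcon
    nlinarith [mul_lt_mul_of_pos_left (not_le.mp hcon) ht, mul_le_mul_of_nonneg_left hu' hs.le]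
  exact hq.2 u ⟨hu, hsu⟩ v ⟨hv, htv⟩ huv

/-- Reduces positive probability to exhibiting a single outcome in the support. -/
theorem roundingLaw_pos {x : P.Col → ℝ} {S : Set P.Outcome}
    {J : P.Outcome} (hJ : J ∈ S) (hpos : ∀ i, 0 < x ⟨i, J i⟩) : 0 < P.roundingLaw x S := by
  refine lt_of_lt_of_le ?_ (measure_mono (Set.singleton_subset_iff.mpr hJ))
  have : ∀ i, IsFiniteMeasure
      (∑ j, ENNReal.ofReal (x ⟨i, j⟩) • Measure.dirac j : Measure (Fin (P.ℓ i))) := by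
    intro i
    constructor
    simp only [Measure.coe_finsetSum, Finset.sum_apply, Measure.smul_apply, smul_eq_mul,
      measure_univ, mul_one]
    exact ENNReal.sum_lt_top.mpr fun j _ => ENNReal.ofReal_lt_top
  rw [roundingLaw, Measure.pi_singleton, pos_iff_ne_zero, Finset.prod_ne_zero_iff]
  intro i _
  simp only [Measure.coe_finsetSum, Finset.sum_apply, Measure.smul_apply, smul_eq_mul]
  refine (lt_of_lt_of_le ?_ (Finset.single_le_sum (fun _ _ => zero_le) (Finset.mem_univ (J i)))).ne'
  simpa using hpos i

end MinimaxIP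

/-! ### Row sums of the rounded vector and application of the local lemma. -/

namespace MinimaxIP

variable {P : MinimaxIP}

theorem mulVec_rounded (J : P.Outcome) (r : Fin P.m) :
    (P.A.mulVec (P.rounded J)) r = ∑ i, P.A r ⟨i, J i⟩ := by
  simp [Matrix.mulVec, dotProduct, rounded, Fintype.sum_sigma]

theorem mulVec_eq_sum_sum (x : P.Col → ℝ) (r : Fin P.m) :
    (P.A.mulVec x) r = ∑ i, ∑ j, x ⟨i, j⟩ * P.A r ⟨i, j⟩ := by
  simp [Matrix.mulVec, dotProduct, Fintype.sum_sigma, mul_comm]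

theorem isFeasible_rounded {J : P.Outcome} {W : ℝ} (h : ∀ r, ∑ i, P.A r ⟨i, J i⟩ ≤ W) :
    P.IsFeasible (P.rounded J) W where
  sum_eq_one i := by simp [rounded]
  row_le r := (mulVec_rounded J r).trans_le (h r)
  integral c := by
    unfold rounded
    split_ifs <;> simp

open Classical in
/-- The rows with a nonzero coefficient at some variable of the group `i`. -/
noncomputable def rowsOfGroup (P : MinimaxIP) (i : Fin P.n) : Finset (Fin P.m) :=
  Finset.univ.filter fun r => ∃ j, P.A r ⟨i, j⟩ ≠ 0

theorem card_rowsOfGroup_le (i : Fin P.n) : (P.rowsOfGroup i).card ≤ P.t := by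
  have h : (P.rowsOfGroup i).card = Set.ncard {r : Fin P.m | ∃ j, P.A r ⟨i, j⟩ ≠ 0} := by
    rw [← Set.ncard_coe_finset]
    congr 1
    ext r
    simp [rowsOfGroup]
  rw [h]
  exact Finset.le_sup (f := fun i : Fin P.n =>
    Set.ncard {r : Fin P.m | ∃ j, P.A r ⟨i, j⟩ ≠ 0}) (Finset.mem_univ i)

theorem eq_zero_of_notMem_rowsOfGroup {i : Fin P.n} {r : Fin P.m} (h : r ∉ P.rowsOfGroup i)
    (j : Fin (P.ℓ i)) : P.A r ⟨i, j⟩ = 0 := by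
  by_contra hne
  exact h (by simpa [rowsOfGroup] using ⟨j, hne⟩)

theorem eq_of_ne_zero_of_eq_one {x : P.Col → ℝ} {y : ℝ} (h : (x, y) ∈ P.lpFeasible) {i : Fin P.n}
    {j j' : Fin (P.ℓ i)} (hj : x ⟨i, j⟩ = 1) (hj' : x ⟨i, j'⟩ ≠ 0) : j' = j := by
  by_contra hne
  have h1 := Finset.add_sum_erase Finset.univ (fun j => x ⟨i, j⟩) (Finset.mem_univ j)
  have h2 := Finset.single_le_sum (f := fun j => x ⟨i, j⟩) (fun j _ => (h.2.2 ⟨i, j⟩).1)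
    (Finset.mem_erase.mpr ⟨hne, Finset.mem_univ j'⟩)
  have h3 := h.1 i
  have h4 := (h.2.2 ⟨i, j'⟩).1.lt_of_ne hj'.symm
  simp only at h1 h2 h3 h4
  linarith

theorem prod_div_mono {ν μ : ℝ} (hν : 0 ≤ ν) (h : ν ≤ μ) (k : ℕ) :
    ∏ j ∈ Finset.range k, ν / (ν + (j + 1)) ≤ ∏ j ∈ Finset.range k, μ / (μ + (j + 1)) := by
  refine Finset.prod_le_prod (fun j _ => by positivity) fun j _ => ?_
  have hj : (0 : ℝ) < (j : ℝ) + 1 := by positivity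
  rw [div_le_div_iff₀ (by linarith) (by linarith)]
  nlinarith

/-- If few groups are fractional, some outcome of the rounding that has positive probability
increases no row by more than `⌈μ δ⌉`. -/
theorem exists_outcome_row_le {x : P.Col → ℝ} {y : ℝ} (hf : (x, y) ∈ P.lpFeasible)
    (hfrac : (Finset.univ.filter fun i : Fin P.n => ∀ j, x ⟨i, j⟩ ≠ 1).card ≤ P.m)
    {μ δ : ℝ} (hμ : 0 < μ) (hμy : min y P.m ≤ μ) (ht : 0 < P.t)
    (hδ : δ ∈ admissibleDeviations μ (1 / (Real.exp 1 * (P.t : ℝ)))) :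
    ∃ J : P.Outcome, (∀ i, 0 < x ⟨i, J i⟩) ∧
      ∀ r, ∑ i, P.A r ⟨i, J i⟩ ≤ y + ((⌈μ * δ⌉ : ℤ) : ℝ) := by
  classical
  obtain ⟨hδ0, hδG⟩ := hδ
  obtain ⟨k, hk⟩ : ∃ k : ℕ, ⌈μ * δ⌉ = k := Int.eq_ofNat_of_zero_le (Int.ceil_nonneg (by positivity))
  have hk0 : 0 < k := by
    have : 0 < ⌈μ * δ⌉ := Int.ceil_pos.mpr (by positivity)
    omega
  have hμδ : μ * δ ≤ k := by
    have := Int.le_ceil (μ * δ)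
    rw [hk] at this
    exact_mod_cast this
  rw [hk] at hδG ⊢
  simp only [Int.cast_natCast] at hδG ⊢
  -- A summand on k groups touches at most kt rows, and the row it belongs to is one of them.
  obtain ⟨d, hd⟩ : ∃ d, k * P.t = d + 1 := ⟨k * P.t - 1, by have := Nat.mul_pos hk0 ht; omega⟩
  obtain ⟨β, hβ0, hβ1, hβ⟩ := exists_inv_exp_mul_le_weight d
  let p : ∀ i : Fin P.n, Fin (P.ℓ i) → ℝ := fun i j => x ⟨i, j⟩
  have hp : ∀ i, ∑ j, p i j = 1 := hf.1
  have hp0 : ∀ i j, 0 ≤ p i j := fun i j => (hf.2.2 ⟨i, j⟩).1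
  have hA0 : ∀ r c, 0 ≤ P.A r c := fun r c => (P.A_mem r c).1
  have hA1 : ∀ r c, P.A r c ≤ 1 := fun r c => (P.A_mem r c).2
  let mean : Fin P.m → Fin P.n → ℝ := fun r i => ∑ j, p i j * P.A r ⟨i, j⟩
  have hmean0 : ∀ r i, 0 ≤ mean r i := fun r i =>
    Finset.sum_nonneg fun j _ => mul_nonneg (hp0 i j) (hA0 _ _)
  have hmean1 : ∀ r i, mean r i ≤ 1 := fun r i =>
    (Finset.sum_le_sum fun j _ => mul_le_of_le_one_right (hp0 i j) (hA1 _ _)).trans_eq (hp i)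
  -- Only groups meeting row r are kept, which guarantees that r is among the rows touched by any
  -- nonempty `T ⊆ F r`.
  let F : Fin P.m → Finset (Fin P.n) := fun r =>
    (Finset.univ.filter fun i : Fin P.n => ∀ j, x ⟨i, j⟩ ≠ 1).filter fun i => r ∈ P.rowsOfGroup i
  let ν : Fin P.m → ℝ := fun r => ∑ i ∈ F r, mean r i
  have hν0 : ∀ r, 0 ≤ ν r := fun r => Finset.sum_nonneg fun i _ => hmean0 r i
  have hmeany : ∀ r, ∑ i, mean r i ≤ y := fun r =>
    (mulVec_eq_sum_sum x r).symm.trans_le (hf.2.1 r)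
  have hνμ : ∀ r, ν r ≤ μ := by
    refine fun r => (le_min ?_ ?_).trans hμy
    · exact (Finset.sum_le_univ_sum_of_nonneg (hmean0 r)).trans (hmeany r)
    · calc ν r ≤ ∑ i ∈ F r, (1 : ℝ) := Finset.sum_le_sum fun i _ => hmean1 r i
        _ = (F r).card := by simp
        _ ≤ P.m := by exact_mod_cast (Finset.card_filter_le _ _).trans hfrac
  let D : Fin P.m → ℝ := fun r => ∏ j ∈ Finset.range k, (ν r + (j + 1))
  have hD : ∀ r, 0 < D r := fun r => Finset.prod_pos fun j _ => by
    have := hν0 r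
    positivity
  let B : Fin P.m → Set P.Outcome := fun r => {J | y + k < ∑ i, P.A r ⟨i, J i⟩}
  let C : Fin P.m → Finset (Fin P.n) → P.Outcome → ℝ := fun r T J =>
    k.factorial / D r * ∏ i ∈ T, P.A r ⟨i, J i⟩
  have hcoef : ∀ r, 0 ≤ k.factorial / D r := fun r => div_nonneg (Nat.cast_nonneg _) (hD r).le
  have hsupp : ∀ J, prodWeight p J ≠ 0 → ∀ i, p i (J i) ≠ 0 := fun J hJ i =>
    Finset.prod_ne_zero_iff.mp hJ i (Finset.mem_univ i)
  have havoid : ∃ J, 0 < prodWeight p J ∧ ∀ r, J ∉ B r := by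
    refine exists_avoiding_of_local (prodWeight p)
      (fun J => Finset.prod_nonneg fun i _ => hp0 i (J i)) (sum_prodWeight hp) B
      (fun r => (F r).powersetCard k) C (fun _ T => T.biUnion P.rowsOfGroup) d β hβ0 hβ1
      (fun r T _ J => mul_nonneg (hcoef r) (Finset.prod_nonneg fun i _ => hA0 _ _))
      ?_ ?_ ?_ ?_
    · intro r T hT
      rw [Finset.mem_powersetCard] at hT
      obtain ⟨i, hi⟩ : T.Nonempty := Finset.card_pos.mp (by omega)
      have hr : r ∈ T.biUnion P.rowsOfGroup :=
        Finset.mem_biUnion.mpr ⟨i, hi, (Finset.mem_filter.mp (hT.1 hi)).2⟩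
      have h1 : (T.biUnion P.rowsOfGroup).card ≤ T.card * P.t :=
        Finset.card_biUnion_le_card_mul _ _ _ fun i _ => card_rowsOfGroup_le i
      rw [hT.2, hd] at h1
      rw [Finset.card_erase_of_mem hr]
      omega
    · intro r T hT I hI
      have h := sum_prodWeight_mul_mul hp T (f := C r T)
        (g := fun J => if ∀ q ∈ I, J ∉ B q then 1 else 0) ?_ ?_
      · simpa [avoidSum] using h
      · intro J J' hJ
        simp only [C]
        congr 1
        exact Finset.prod_congr rfl fun i hi => by rw [hJ i hi]
      · intro J J' hJ
        have h1 : ∀ q ∈ I, (J ∉ B q ↔ J' ∉ B q) := by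
          intro q hq
          have h2 : ∑ i, P.A q ⟨i, J i⟩ = ∑ i, P.A q ⟨i, J' i⟩ := by
            refine Finset.sum_congr rfl fun i _ => ?_
            by_cases hi : i ∈ T
            · have h3 : q ∉ P.rowsOfGroup i := fun h =>
                Finset.disjoint_left.mp hI hq (Finset.mem_biUnion.mpr ⟨i, hi, h⟩)
              rw [eq_zero_of_notMem_rowsOfGroup h3, eq_zero_of_notMem_rowsOfGroup h3]
            · rw [hJ i hi]
          simp only [B, Set.mem_ofPred_eq, h2]
        have h2 : (∀ q ∈ I, J ∉ B q) ↔ ∀ q ∈ I, J' ∉ B q := forall₂_congr h1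
        simp only [h2]
    · intro r J hJ hB
      -- A group outside `F r` either misses row r or has a forced choice, so all the excess over y
      -- must come from `F r`.
      have hrest : ∑ i ∈ (F r)ᶜ, P.A r ⟨i, J i⟩ = ∑ i ∈ (F r)ᶜ, mean r i := by
        refine Finset.sum_congr rfl fun i hi => ?_
        by_cases hr : r ∈ P.rowsOfGroup i
        · have h1 : ∃ j, x ⟨i, j⟩ = 1 := by
            by_contra hcon
            push Not at hcon
            exact Finset.mem_compl.mp hi (by simpa [F, hr] using hcon)
          obtain ⟨j, hj⟩ := h1
          rw [eq_of_ne_zero_of_eq_one hf hj (hsupp J hJ i)]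
          simp only [mean]
          rw [Finset.sum_eq_single j]
          · simp [p, hj]
          · intro j' _ hne
            have : p i j' = 0 := by
              by_contra h0
              exact hne (eq_of_ne_zero_of_eq_one hf hj h0)
            rw [this, zero_mul]
          · simp
        · simp [mean, eq_zero_of_notMem_rowsOfGroup hr]
      have hlarge : ν r + k ≤ ∑ i ∈ F r, P.A r ⟨i, J i⟩ := by
        have h1 : y + k < ∑ i, P.A r ⟨i, J i⟩ := hB
        have h2 := Finset.sum_add_sum_compl (F r) fun i => P.A r ⟨i, J i⟩
        have h3 := Finset.sum_add_sum_compl (F r) (mean r)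
        have h4 := hmeany r
        simp only [ν] at *
        linarith
      have h1 : D r ≤ k.factorial * esymmSum (fun i => P.A r ⟨i, J i⟩) (F r) k :=
        prod_le_factorial_mul_esymmSum (fun i _ => ⟨hA0 _ _, hA1 _ _⟩) (hν0 r) k hlarge
      simp only [C]
      rw [← Finset.mul_sum, div_mul_eq_mul_div, one_le_div (hD r)]
      exact h1
    · intro r
      refine le_trans ?_ hβ
      have h1 : ∀ T, ∑ J, prodWeight p J * C r T J = k.factorial / D r * ∏ i ∈ T, mean r i := by
        intro T
        rw [← sum_prodWeight_mul_prod hp (fun i j => P.A r ⟨i, j⟩) T, Finset.mul_sum]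
        exact Finset.sum_congr rfl fun J _ => by simp only [C]; ring
      simp only [h1]
      rw [← Finset.mul_sum]
      have h2 : k.factorial * esymmSum (mean r) (F r) k ≤ ν r ^ k :=
        factorial_mul_esymmSum_le_pow (fun i _ => hmean0 r i) k
      have h3 : ν r ^ k / D r = ∏ j ∈ Finset.range k, ν r / (ν r + (j + 1)) := by
        rw [Finset.prod_div_distrib, Finset.prod_const, Finset.card_range]
      have h4 : (k : ℝ) * P.t = d + 1 := by exact_mod_cast hd
      calc k.factorial / D r * esymmSum (mean r) (F r) k
          = k.factorial * esymmSum (mean r) (F r) k / D r := by ring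
        _ ≤ ν r ^ k / D r := div_le_div_of_nonneg_right h2 (hD r).le
        _ ≤ chernoffG μ δ := by
            rw [h3]
            exact (prod_div_mono (hν0 r) (hνμ r) k).trans (prod_div_le_chernoffG hμ hδ0.le hμδ)
        -- The factor ⌈μδ⌉ in the definition of H supplies the division by k, turning 1/(et) into
        -- the threshold 1/(e(d+1)).
        _ ≤ 1 / (Real.exp 1 * P.t) / k := by
            rw [le_div_iff₀ (by exact_mod_cast hk0)]
            linarith
        _ = 1 / (Real.exp 1 * (d + 1)) := by
            rw [← h4, div_div]
            congr 1
            ring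
  obtain ⟨J, hJ, hJB⟩ := havoid
  exact ⟨J, fun i => (hp0 i (J i)).lt_of_ne (hsupp J hJ.ne' i).symm, fun r => not_lt.mp (hJB r)⟩

theorem exists_pos_outcome {x : P.Col → ℝ} {y : ℝ} (hf : (x, y) ∈ P.lpFeasible) :
    ∃ J : P.Outcome, ∀ i, 0 < x ⟨i, J i⟩ := by
  have h : ∀ i, ∃ j, 0 < x ⟨i, j⟩ := by
    intro i
    obtain ⟨j, -, hj⟩ : ∃ j ∈ Finset.univ, x ⟨i, j⟩ ≠ 0 :=
      Finset.exists_ne_zero_of_sum_ne_zero (by rw [hf.1 i]; exact one_ne_zero)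
    exact ⟨j, (hf.2.2 ⟨i, j⟩).1.lt_of_ne hj.symm⟩
  choose J hJ using h
  exact ⟨J, hJ⟩

theorem row_le_zero_of_value_zero {x : P.Col → ℝ} (hf : (x, 0) ∈ P.lpFeasible)
    {J : P.Outcome} (hJ : ∀ i, 0 < x ⟨i, J i⟩) (r : Fin P.m) : ∑ i, P.A r ⟨i, J i⟩ ≤ 0 := by
  have hrow : ∑ c, P.A r c * x c ≤ 0 := hf.2.1 r
  have hnn : ∀ c ∈ Finset.univ, 0 ≤ P.A r c * x c := fun c _ =>
    mul_nonneg (P.A_mem r c).1 (hf.2.2 c).1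
  have hz := (Finset.sum_eq_zero_iff_of_nonneg hnn).mp (hrow.antisymm (Finset.sum_nonneg hnn))
  exact (Finset.sum_eq_zero fun i _ =>
    (mul_eq_zero.mp (hz ⟨i, J i⟩ (Finset.mem_univ _))).resolve_right (hJ i).ne').le

/-- If t = 0 then A = 0, and W could be lowered to 0. -/
theorem t_pos_of_optimal_pos {x : P.Col → ℝ} {y : ℝ} (hf : (x, y) ∈ P.lpFeasible)
    (hopt : ∀ q ∈ P.lpFeasible, y ≤ q.2) (hy : 0 < y) : 0 < P.t := by
  by_contra ht
  have hA : ∀ r c, P.A r c = 0 := by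
    rintro r ⟨i, j⟩
    refine eq_zero_of_notMem_rowsOfGroup ?_ j
    have h1 := card_rowsOfGroup_le (P := P) i
    rw [Finset.card_eq_zero.mp (show (P.rowsOfGroup i).card = 0 by omega)]
    exact Finset.notMem_empty r
  have h0 : (x, (0 : ℝ)) ∈ P.lpFeasible :=
    ⟨hf.1, fun r => by simp [Matrix.mulVec, dotProduct, hA], hf.2.2⟩
  exact absurd (hopt _ h0) (not_le.mpr hy)

end MinimaxIP

theorem theorem4p2 (P : MinimaxIP) (hm : 0 < P.m) (hℓ : ∀ i, 0 < P.ℓ i) :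
    (∃ (x : P.Col → ℝ) (y : ℝ), P.IsOptimalBasic x y) ∧
    ∀ (x : P.Col → ℝ) (y : ℝ), P.IsOptimalBasic x y →
      0 < P.roundingLaw x {J : P.Outcome | ∃ W : ℝ, P.IsFeasible (P.rounded J) W ∧
        W ≤ y + ((⌈min y (P.m : ℝ) *
          deviationH (min y (P.m : ℝ)) (1 / (Real.exp 1 * (P.t : ℝ)))⌉ : ℤ) : ℝ)} := by
  refine ⟨MinimaxIP.exists_isOptimalBasic hm hℓ, fun x y h => ?_⟩
  have hf := h.basic.1
  have hm' : (0 : ℝ) < P.m := by exact_mod_cast hm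
  -- For y = 0 the function H is of no use, as μ = 0; but then every variable in the support has
  -- zero coefficients, and any outcome of positive probability has value 0.
  rcases (MinimaxIP.nonneg_of_mem_lpFeasible hm hf : 0 ≤ y).eq_or_lt with rfl | hy
  · obtain ⟨J, hJ⟩ := MinimaxIP.exists_pos_outcome hf
    refine MinimaxIP.roundingLaw_pos (J := J) ⟨0, ?_, ?_⟩ hJ
    · exact MinimaxIP.isFeasible_rounded (MinimaxIP.row_le_zero_of_value_zero hf hJ)
    · simp
  · have hμ : 0 < min y (P.m : ℝ) := lt_min hy hm'
    have ht := MinimaxIP.t_pos_of_optimal_pos hf h.optimal hy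
    have ht' : (1 : ℝ) ≤ P.t := by exact_mod_cast ht
    have hp0 : 0 < 1 / (Real.exp 1 * (P.t : ℝ)) := by positivity
    have hp1 : 1 / (Real.exp 1 * (P.t : ℝ)) < 1 := by
      have := Real.one_lt_exp_iff.mpr (zero_lt_one (α := ℝ))
      rw [div_lt_one (by positivity)]
      nlinarith
    obtain ⟨J, hJ, hrow⟩ := MinimaxIP.exists_outcome_row_le hf
      (MinimaxIP.card_fractional_le h.basic) hμ le_rfl ht (deviationH_isLeast _ _ hμ hp0 hp1).1
    exact MinimaxIP.roundingLaw_pos ⟨_, MinimaxIP.isFeasible_rounded hrow, le_rfl⟩ hJ
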